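/- Let $I\subset\mathbb R$ be any non-degenerate interval (bounded or unbounded; open, half-open or closed). Then there exist a continuous map $f$ from $I$ onto itself that is bitransitive, i.e. $f^2=f\circ f$ is topologically transitive (for all nonempty relatively open $U,V\subset I$ there is an integer $k\ge 1$ with $(f^2)^k(U)\cap V\neq\emptyset$), and a set $S\subset I$ such that: 1. $S$ is invariant: $f(S)\subset S$; 2. $S$ is an extremely scrambled set of $f$: it has at least two points; there is $\beta\in(0,\infty]$ such that for any two distinct points $x,y\in S$ $$\liminf_{n\to\infty}|f^n(x)-f^n(y)|=0\quad\text{and}\quad\limsup_{n\to\infty}|f^n(x)-f^n(y)|\ge\beta;$$ and for any two distinct points $c,d\in S$ and any compact non-degenerate interval $K$ contained in the interior of $I$ there is an integer $n\ge1$ such that the closed interval with endpoints $f^n(c)$ and $f^n(d)$ contains $K$; 3. every point $x$ of $S$ is a transitive point of $f$: its orbit $\{f^i(x): i\ge 0\}$ is dense in $I$; 4. $S$ has full Lebesgue measure in $I$, i.e. $I\setminus S$ has Lebesgue measure $0$. -/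

import Mathlib

open Set Filter Topology MeasureTheory
open scoped ENNReal

namespace IntervalDynamics

/-- A self-map `f` of a topological space is (topologically) transitive if for all nonempty open
sets `U`, `V` some iterate `f^k` with `k ≥ 1` sends a point of `U` into `V`. -/
def IsTransitive {X : Type*} [TopologicalSpace X] (f : X → X) : Prop :=
  ∀ U V : Set X, IsOpen U → IsOpen V → U.Nonempty → V.Nonempty →
    ∃ k : ℕ, 0 < k ∧ ((f^[k] '' U) ∩ V).Nonempty

/-- `f` is bitransitive if its second iterate is transitive. -/
def IsBitransitive {X : Type*} [TopologicalSpace X] (f : X → X) : Prop :=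
  IsTransitive (f^[2])

/-- `x` is a transitive point of `f` if its orbit `{f^i(x) : i ≥ 0}` is dense. -/
def IsTransitivePoint {X : Type*} [TopologicalSpace X] (f : X → X) (x : X) : Prop :=
  Dense (range fun i : ℕ => f^[i] x)

/-- `S` is a `β`-scrambled set of `f : I → I`. The distances `|f^n(x) - f^n(y)|` are taken with
values in `[0, ∞]`, so that for `β = ∞` the last condition says that the upper limit is `∞`. -/
def IsScrambledSet {I : Set ℝ} (f : I → I) (β : ℝ≥0∞) (S : Set I) : Prop :=
  S.Nontrivial ∧ ∀ x ∈ S, ∀ y ∈ S, x ≠ y →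
    liminf (fun n : ℕ => edist (f^[n] x) (f^[n] y)) atTop = 0 ∧
    β ≤ limsup (fun n : ℕ => edist (f^[n] x) (f^[n] y)) atTop

/-- `S` is an extremely scrambled set of `f : I → I`: it is `β`-scrambled for some `β` with
`0 < β ≤ ∞` and, for any two distinct points `c`, `d` of `S` and any compact interval `K` in the
interior of `I`, some interval with endpoints `f^n(c)` and `f^n(d)`, `n ≥ 1`, contains `K`. -/
def IsExtremelyScrambledSet {I : Set ℝ} (f : I → I) (S : Set I) : Prop :=
  (∃ β : ℝ≥0∞, 0 < β ∧ IsScrambledSet f β S) ∧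
  ∀ c ∈ S, ∀ d ∈ S, c ≠ d →
    ∀ u v : ℝ, u < v → Icc u v ⊆ interior I →
      ∃ n : ℕ, 0 < n ∧ Icc u v ⊆ uIcc (f^[n] c : ℝ) (f^[n] d : ℝ)

end IntervalDynamics

/-! Full Lebesgue measure is obtained last, by a change of coordinates. It is enough to find one map
`f` of `I` and a set `S` with all the topological properties such that `S` has full measure for some
atomless Borel probability `μ` charging every nonempty open set. An increasing homeomorphism `e` of
`I` then carries `μ` to a probability measure whose null sets are Lebesgue null
(`exists_orderIso_map_eq`, by comparing distribution functions). Conjugating `f` by `e` preserves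
density of orbits, proximality and covering of compact intervals.

To build `S`, suppose every nondegenerate interval eventually covers every compact interval. Then
countably many itinerary conditions can be met at times that do not depend on the itinerary, by
points `φ α` depending measurably on a real parameter `α` (`exists_measurable_itinerary`). The
conditions in `IsExtremelyMixing.exists_coding` make the orbit of each `φ α` dense, bring any two
orbits together near a fixed point, and throw `f^[m] (φ α)` and `f^[n] (φ β)` far apart whenever
`(m, α) ≠ (n, β)`. The union of all `f^[n] '' range φ` is invariant and scrambled, and a weighted
sum of the images of a probability on `ℝ` is the required `μ`
(`IsExtremelyMixing.exists_isScramblingSet`).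

Suitable maps are `1 - 2x²` on a compact interval and piecewise expanding oscillations of growing
amplitude on a half-line and on the line. Every interval is order isomorphic to one of these models
or to a reflected half-line. -/

namespace IntervalDynamics

/-! ### Mixing maps and measurable itineraries -/

/-- A continuous map with a fixed point, all of whose nondegenerate intervals eventually cover every
compact interval, and which has, on either side of any compact interval in the interior of the
space, nondegenerate intervals `L₀` and `L₁` such that `L₀` and `L₁` both cover `L₁`. -/
structure IsExtremelyMixing {X : Type*} [LinearOrder X] [TopologicalSpace X] (f : X → X) :
    Prop where
  continuous : Continuous f
  exists_fixed : ∃ p, f p = p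
  eventually_cover : ∀ a b u v : X, a < b → ∀ᶠ n in atTop, Icc u v ⊆ f^[n] '' Icc a b
  exists_far : ∀ u v : X, ¬IsMin u → ¬IsMax v → ∃ a₀ b₀ a₁ b₁ : X, a₀ < b₀ ∧ a₁ < b₁ ∧
    (∀ x ∈ Icc a₀ b₀, ∀ y ∈ Icc a₁ b₁, Icc u v ⊆ uIcc x y) ∧
    Icc a₁ b₁ ⊆ f '' Icc a₀ b₀ ∧ Icc a₁ b₁ ⊆ f '' Icc a₁ b₁

/-- A compact set whose iterated images eventually cover every compact set. -/
structure IsTarget {X : Type*} [TopologicalSpace X] (f : X → X) (Q : Set X) : Prop where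
  isCompact : IsCompact Q
  eventually_cover : ∀ K : Set X, IsCompact K → ∀ᶠ n in atTop, K ⊆ f^[n] '' Q

theorem IsTarget.of_cover {X : Type*} [TopologicalSpace X] {f : X → X} {Q Q' : Set X}
    (hQ' : IsTarget f Q') (hQ : IsCompact Q) {k : ℕ} (h : Q' ⊆ f^[k] '' Q) : IsTarget f Q := by
  refine ⟨hQ, fun K hK => ?_⟩
  filter_upwards [(tendsto_sub_atTop_nat k).eventually (hQ'.eventually_cover K hK),
    eventually_ge_atTop k] with n hn hkn
  refine hn.trans ((image_mono h).trans ?_)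
  rw [← image_comp, ← Function.iterate_add, Nat.sub_add_cancel hkn]

theorem IsTarget.nonempty {X : Type*} [TopologicalSpace X] [Nonempty X] {f : X → X} {Q : Set X}
    (hQ : IsTarget f Q) : Q.Nonempty := by
  obtain ⟨x⟩ := ‹Nonempty X›
  obtain ⟨n, hn⟩ := (hQ.eventually_cover {x} isCompact_singleton).exists
  obtain ⟨y, hy, -⟩ := hn rfl
  exact ⟨y, hy⟩

/-- A prescribed itinerary, depending on the comparison of a real parameter with countably many
thresholds, is followed by points depending measurably on the parameter. -/
theorem exists_measurable_itinerary {X : Type*} [LinearOrder X] [TopologicalSpace X]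
    [OrderTopology X] [SecondCountableTopology X] [MeasurableSpace X] [BorelSpace X] [Nonempty X]
    {f : X → X} (hf : Continuous f) {A B : ℕ → Set X}
    (hA : ∀ i, IsTarget f (A i)) (hB : ∀ i, IsTarget f (B i)) (q : ℕ → ℝ) :
    ∃ t : ℕ → ℕ, ∃ φ : ℝ → X, Measurable φ ∧
      ∀ i α, (α < q i → f^[t i] (φ α) ∈ A i) ∧ (q i ≤ α → f^[t i] (φ α) ∈ B i) := by
  classical
  let Q : ℕ → Prop → Set X := fun i s => {x | (s ∧ x ∈ A i) ∨ (¬s ∧ x ∈ B i)}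
  have hQt : ∀ i s, IsTarget f (Q i s) := by
    intro i s
    by_cases hs : s
    · simpa [Q, hs] using hA i
    · simpa [Q, hs] using hB i
  -- One waiting time `d` serves all four transitions between `A i`, `B i` and `A (i + 1)`, `B (i +
  -- 1)`, so the times `t` do not depend on the itinerary.
  have hd : ∀ i, ∃ d, ∀ s s', Q (i + 1) s' ⊆ f^[d] '' Q i s := by
    intro i
    have hK := (hA (i + 1)).isCompact.union (hB (i + 1)).isCompact
    obtain ⟨d, h1, h2⟩ := (((hA i).eventually_cover _ hK).and ((hB i).eventually_cover _ hK)).exists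
    refine ⟨d, fun s s' => ?_⟩
    have : Q (i + 1) s' ⊆ A (i + 1) ∪ B (i + 1) := by
      rintro x (⟨-, h⟩ | ⟨-, h⟩)
      exacts [Or.inl h, Or.inr h]
    refine this.trans ?_
    by_cases hs : s
    · simpa [Q, hs] using h1
    · simpa [Q, hs] using h2
  choose d hd using hd
  let t : ℕ → ℕ := fun n => ∑ j ∈ Finset.range n, d j
  let Y : ℕ → (ℕ → Prop) → Set X := fun n s => {x | ∀ i ≤ n, f^[t i] x ∈ Q i (s i)}
  have hYne : ∀ n s, Q n (s n) ⊆ f^[t n] '' Y n s := by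
    intro n s
    induction n with
    | zero =>
      intro z hz
      refine ⟨z, fun i hi => ?_, by simp [t]⟩
      obtain rfl : i = 0 := by omega
      simpa [t] using hz
    | succ n ih =>
      intro z hz
      obtain ⟨w, hw, rfl⟩ := hd n (s n) (s (n + 1)) hz
      obtain ⟨x, hx, rfl⟩ := ih hw
      have ht : f^[t (n + 1)] x = f^[d n] (f^[t n] x) := by
        rw [← Function.iterate_add_apply, add_comm (d n)]
        simp [t, Finset.sum_range_succ]
      refine ⟨x, fun i hi => ?_, ht⟩
      rcases Nat.le_succ_iff.mp hi with hi | rfl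
      · exact hx i hi
      · rw [Nat.succ_eq_add_one, ht]; exact hz
  have hYcl : ∀ n s, IsClosed (Y n s) := by
    intro n s
    simp only [Y, ofPred_forall]
    exact isClosed_iInter fun i => isClosed_iInter fun _ =>
      (hQt i (s i)).isCompact.isClosed.preimage (hf.iterate _)
  have hYanti : ∀ s, Antitone fun n => Y n s :=
    fun s m n hmn x hx i hi => hx i (hi.trans hmn)
  have hY0 : ∀ s, IsCompact (Y 0 s) := by
    intro s
    refine (hQt 0 (s 0)).isCompact.of_isClosed_subset (hYcl 0 s) fun x hx => ?_
    simpa [t] using hx 0 le_rfl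
  have hinter : ∀ s (F : Set X), IsClosed F → (∀ n, (Y n s ∩ F).Nonempty) →
      ((⋂ n, Y n s) ∩ F).Nonempty := by
    intro s F hF h
    rw [iInter_inter]
    refine IsCompact.nonempty_iInter_of_sequence_nonempty_isCompact_isClosed _
      (fun n => inter_subset_inter_left _ (hYanti s n.le_succ)) h ((hY0 s).inter_right hF)
      fun n => (hYcl n s).inter hF
  have hne : ∀ s, (⋂ n, Y n s).Nonempty := by
    intro s
    simpa using hinter s univ isClosed_univ fun n => by
      obtain ⟨z, hz⟩ := (hQt n (s n)).nonempty
      obtain ⟨x, hx, -⟩ := hYne n s hz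
      simpa using ⟨x, hx⟩
  have hcomp : ∀ s, IsCompact (⋂ n, Y n s) := fun s =>
    (hY0 s).of_isClosed_subset (isClosed_iInter fun n => hYcl n s) (iInter_subset _ 0)
  -- Taking the least point that follows the itinerary is a canonical choice, and this is what makes
  -- measurability provable.
  have hleast := fun s => (hcomp s).exists_isLeast (hne s)
  choose ψ hψ using hleast
  have hfin : ∀ n s, Y n s = Y n (fun i => i ∈ (Finset.range (n + 1)).filter s) := by
    intro n s
    ext x
    refine forall_congr' fun i => forall_congr' fun hi => ?_
    have : (i ∈ (Finset.range (n + 1)).filter s) = s i := by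
      simp [Nat.lt_succ_of_le hi]
    simp only [this]
  refine ⟨t, fun α => ψ fun i => α < q i, ?_, fun i α => ?_⟩
  · refine measurable_of_Iic fun c => ?_
    -- By compactness, the least point is at most `c` exactly when every finite stage meets `Iic c`.
    -- A finite stage sees only finitely many comparisons `α < q i`.
    have : (fun α => ψ fun i => α < q i) ⁻¹' Iic c =
        ⋂ n, {α | (Y n (fun i => α < q i) ∩ Iic c).Nonempty} := by
      ext α
      simp only [mem_preimage, mem_Iic, mem_iInter, mem_ofPred_eq]
      constructor
      · exact fun h n => ⟨_, mem_iInter.mp (hψ _).1 n, h⟩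
      · intro h
        obtain ⟨x, hx, hxc⟩ := hinter _ _ isClosed_Iic h
        exact ((hψ _).2 hx).trans hxc
    rw [this]
    refine MeasurableSet.iInter fun n => ?_
    let g : ℝ → Finset ℕ := fun α => (Finset.range (n + 1)).filter fun i => α < q i
    have hg : @Measurable _ _ _ ⊤ g := by
      let _ : MeasurableSpace (Finset ℕ) := ⊤
      refine measurable_to_countable' fun T => ?_
      have : g ⁻¹' {T} = {α | ∀ i, (i ∈ Finset.range (n + 1) ∧ α < q i) ↔ i ∈ T} := by
        ext α
        simp [g, Finset.ext_iff]
      rw [this, ofPred_forall]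
      refine MeasurableSet.iInter fun i => measurableSet_setOfPred.mpr ?_
      refine Measurable.iff (Measurable.and measurable_const ?_) measurable_const
      exact measurableSet_setOfPred.mp measurableSet_Iio
    have : {α | (Y n (fun i => α < q i) ∩ Iic c).Nonempty} =
        g ⁻¹' {T | (Y n (fun i => i ∈ T) ∩ Iic c).Nonempty} := by
      ext α
      simp only [mem_preimage, mem_ofPred_eq]
      rw [hfin]
    rw [this]
    exact @hg _ trivial
  · have := mem_iInter.mp (hψ fun i => α < q i).1 i i le_rfl
    constructor
    · intro h
      simpa [Q, h] using this
    · intro h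
      simpa [Q, h.not_gt, h] using this

theorem exists_measurable_itinerary_of_countable {X : Type*} [LinearOrder X] [TopologicalSpace X]
    [OrderTopology X] [SecondCountableTopology X] [MeasurableSpace X] [BorelSpace X] [Nonempty X]
    {f : X → X} (hf : Continuous f) {T : Set (Set X × Set X × ℝ)} (hT : T.Countable)
    (hne : T.Nonempty) (hA : ∀ τ ∈ T, IsTarget f τ.1) (hB : ∀ τ ∈ T, IsTarget f τ.2.1) :
    ∃ φ : ℝ → X, Measurable φ ∧ ∀ τ ∈ T, ∃ t : ℕ, ∀ α,
      (α < τ.2.2 → f^[t] (φ α) ∈ τ.1) ∧ (τ.2.2 ≤ α → f^[t] (φ α) ∈ τ.2.1) := by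
  obtain ⟨e, rfl⟩ := hT.exists_eq_range hne
  obtain ⟨t, φ, hφ, h⟩ := exists_measurable_itinerary hf (fun i => hA _ (mem_range_self i))
    (fun i => hB _ (mem_range_self i)) (fun i => (e i).2.2)
  refine ⟨φ, hφ, ?_⟩
  rintro _ ⟨i, rfl⟩
  exact ⟨t i, h i⟩

/-! ### Coding: a real parameter family of mutually scrambled points -/

theorem exists_Icc_subset_of_isOpen {X : Type*} [LinearOrder X] [TopologicalSpace X]
    [OrderTopology X] [DenselyOrdered X] [Nontrivial X] {U : Set X} (hU : IsOpen U)
    (hne : U.Nonempty) : ∃ a b, a < b ∧ Icc a b ⊆ U := by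
  obtain ⟨a, b, hab, h⟩ := hU.exists_Ioo_subset hne
  obtain ⟨c, hac, hcb⟩ := exists_between hab
  obtain ⟨d, hcd, hdb⟩ := exists_between hcb
  exact ⟨c, d, hcd, (Icc_subset_Ioo hac hdb).trans h⟩

/-- Together with its order dual, this reduces the covering of all intervals `Icc u v` with
non-extremal endpoints to countably many conditions. -/
theorem exists_countable_not_isMin {X : Type*} [LinearOrder X]
    [TopologicalSpace X] [OrderTopology X] [DenselyOrdered X] [Nontrivial X] [SecondCountableTopology X] :
    ∃ D : Set X, D.Countable ∧ (∀ x ∈ D, ¬IsMin x) ∧ ∀ u : X, ¬IsMin u → ∃ x ∈ D, x ≤ u := by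
  obtain ⟨D, hD, hd⟩ := TopologicalSpace.exists_countable_dense X
  refine ⟨{x ∈ D | ¬IsMin x}, hD.mono (sep_subset _ _), fun x hx => hx.2, fun u hu => ?_⟩
  obtain ⟨w, hw⟩ := not_isMin_iff.mp hu
  obtain ⟨x, hx, hxD⟩ := hd.exists_between hw
  exact ⟨x, ⟨hx, not_isMin_iff.mpr ⟨w, hxD.1⟩⟩, hxD.2.le⟩

section

variable {X : Type*} [LinearOrder X] [TopologicalSpace X] [OrderTopology X] [CompactIccSpace X]
  {f : X → X}

theorem IsExtremelyMixing.isTarget_Icc (hf : IsExtremelyMixing f) {a b : X} (hab : a < b) :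
    IsTarget f (Icc a b) := by
  refine ⟨isCompact_Icc, fun K hK => ?_⟩
  have : Nonempty X := ⟨a⟩
  obtain ⟨u, hu⟩ := hK.bddBelow
  obtain ⟨v, hv⟩ := hK.bddAbove
  filter_upwards [hf.eventually_cover a b u v hab] with n hn
  exact fun x hx => hn ⟨hu hx, hv hx⟩

/-- Two sets of starting points: those of the first go far to one side at time `k` and stay far to
the other side until time `3k`, while those of the second are far to the first side at
time `2k`. -/
theorem IsExtremelyMixing.exists_far_targets (hf : IsExtremelyMixing f) {u v : X}
    (hu : ¬IsMin u) (hv : ¬IsMax v) (k₀ : ℕ) :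
    ∃ k ≥ k₀, ∃ A B : Set X, IsTarget f A ∧ IsTarget f B ∧
      (∀ x ∈ A, ∀ l, 1 ≤ l → l ≤ 2 * k → Icc u v ⊆ uIcc (f^[k] x) (f^[k + l] x)) ∧
      ∀ x ∈ A, ∀ y ∈ B, ∀ l, 1 ≤ l → l ≤ 2 * k →
        Icc u v ⊆ uIcc (f^[2 * k] y) (f^[k + l] x) := by
  obtain ⟨a₀, b₀, a₁, b₁, h0, h1, hsep, h01, h11⟩ := hf.exists_far u v hu hv
  have ht0 := hf.isTarget_Icc h0
  have ht1 := hf.isTarget_Icc h1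
  have hcl : ∀ n (a b : X), IsClosed {x | f^[n] x ∈ Icc a b} := fun n a b =>
    isClosed_Icc.preimage (hf.continuous.iterate n)
  -- The interval `Icc a₀ b₀` must cover itself both in `k` steps, for the first set, and in `2 * k`
  -- steps, for the second.
  obtain ⟨k, hk, hkc⟩ := ((eventually_ge_atTop k₀).and
    ((ht0.eventually_cover _ (isCompact_Icc (a := a₀) (b := b₀))).and
      ((tendsto_id.const_mul_atTop' (show 0 < 2 by norm_num)).eventually
        (ht0.eventually_cover _ (isCompact_Icc (a := a₀) (b := b₀)))))).exists
  refine ⟨k, hk, {x ∈ Icc a₀ b₀ | f^[k] x ∈ Icc a₀ b₀ ∧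
    ∀ l, 1 ≤ l → l ≤ 2 * k → f^[k + l] x ∈ Icc a₁ b₁}, {x ∈ Icc a₀ b₀ | f^[2 * k] x ∈ Icc a₀ b₀},
    ?_, ?_, fun x hx l hl1 hl2 => hsep _ hx.2.1 _ (hx.2.2 l hl1 hl2),
    fun x hx y hy l hl1 hl2 => hsep _ hy.2 _ (hx.2.2 l hl1 hl2)⟩
  · have hcover : ∀ r, Icc a₁ b₁ ⊆ f^[k + (r + 1)] '' {x ∈ Icc a₀ b₀ | f^[k] x ∈ Icc a₀ b₀ ∧
        ∀ l, 1 ≤ l → l ≤ r + 1 → f^[k + l] x ∈ Icc a₁ b₁} := by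
      intro r
      induction r with
      | zero =>
        intro z hz
        obtain ⟨w, hw, rfl⟩ := h01 hz
        obtain ⟨x, hx, rfl⟩ := hkc.1 hw
        refine ⟨x, ⟨hx, hw, fun l hl1 hl2 => ?_⟩, Function.iterate_succ_apply' f k x⟩
        obtain rfl : l = 1 := by omega
        rw [Function.iterate_succ_apply']
        exact hz
      | succ r ih =>
        intro z hz
        obtain ⟨w, hw, rfl⟩ := h11 hz
        obtain ⟨x, ⟨hx, hx0, hx1⟩, rfl⟩ := ih hw
        refine ⟨x, ⟨hx, hx0, fun l hl1 hl2 => ?_⟩,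
          Function.iterate_succ_apply' f (k + (r + 1)) x⟩
        rcases Nat.le_succ_iff.mp hl2 with hl2 | rfl
        · exact hx1 l hl1 hl2
        · rw [Nat.succ_eq_add_one, ← add_assoc k, Function.iterate_succ_apply']
          exact hz
    -- `hcover r` controls `r + 1` steps in `Icc a₁ b₁`, so `r = 2 * k` gives one step more than
    -- needed.
    refine ht1.of_cover ?_ (k := k + (2 * k + 1)) ((hcover (2 * k)).trans (image_mono ?_))
    · refine isCompact_Icc.inter_right ((hcl k a₀ b₀).inter ?_)
      change IsClosed {x | ∀ l, 1 ≤ l → l ≤ 2 * k → f^[k + l] x ∈ Icc a₁ b₁}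
      simp only [ofPred_forall]
      exact isClosed_iInter fun l => isClosed_iInter fun _ => isClosed_iInter fun _ => hcl _ _ _
    · exact fun x hx => ⟨hx.1, hx.2.1, fun l hl1 hl2 => hx.2.2 l hl1 (by omega)⟩
  · refine ht0.of_cover (isCompact_Icc.inter_right (hcl _ _ _)) (k := 2 * k) fun z hz => ?_
    obtain ⟨x, hx, rfl⟩ := hkc.2 hz
    exact ⟨x, ⟨hx, hz⟩, rfl⟩

/-- Three countable families of conditions are imposed: visit each basic open set, stay near `p` for
a long time, and, for each rational `q`, enter `A` or `B` of `exists_far_targets` according to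
whether `α < q`. The shifts `m`, `n` appear because whole forward orbits of the points `φ α` will
enter the scrambled set, including two points of the same orbit. -/
theorem IsExtremelyMixing.exists_coding [DenselyOrdered X] [Nontrivial X]
    [SecondCountableTopology X] [MeasurableSpace X] [BorelSpace X] (hf : IsExtremelyMixing f)
    {p : X} (hp : f p = p) :
    ∃ φ : ℝ → X, Measurable φ ∧ (∀ α, Dense (range fun i => f^[i] (φ α))) ∧
      (∀ m n α β, ∀ V ∈ 𝓝 p, ∃ i, f^[i + m] (φ α) ∈ V ∧ f^[i + n] (φ β) ∈ V) ∧
      ∀ m n α β, (m, α) ≠ (n, β) → ∀ u v : X, ¬IsMin u → ¬IsMax v →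
        ∃ i, 0 < i ∧ Icc u v ⊆ uIcc (f^[i + m] (φ α)) (f^[i + n] (φ β)) := by
  have hbasis : ∀ U : TopologicalSpace.countableBasis X, ∃ Q : Set X, IsTarget f Q ∧ Q ⊆ U := by
    intro U
    obtain ⟨a, b, hab, h⟩ := exists_Icc_subset_of_isOpen
      (TopologicalSpace.isOpen_of_mem_countableBasis U.2)
      (TopologicalSpace.nonempty_of_mem_countableBasis U.2)
    exact ⟨_, hf.isTarget_Icc hab, h⟩
  choose Q hQt hQ using hbasis
  obtain ⟨V, hV⟩ := (𝓝 p).exists_antitone_basis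
  have hnear : ∀ k : ℕ, ∃ Q : Set X, IsTarget f Q ∧ ∀ x ∈ Q, ∀ l ≤ k, f^[l] x ∈ V k := by
    intro k
    have hev : ∀ᶠ x in 𝓝 p, ∀ l ≤ k, f^[l] x ∈ V k := by
      refine (eventually_all_finite (finite_Iic k)).mpr fun l _ => ?_
      have : Tendsto f^[l] (𝓝 p) (𝓝 p) := by
        simpa [Function.iterate_fixed hp] using (hf.continuous.iterate l).tendsto p
      exact this (hV.1.mem_of_mem trivial)
    obtain ⟨U, hU, hUo, hpU⟩ := eventually_nhds_iff.mp hev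
    obtain ⟨a, b, hab, h⟩ := exists_Icc_subset_of_isOpen hUo ⟨p, hpU⟩
    exact ⟨_, hf.isTarget_Icc hab, fun x hx => hU x (h hx)⟩
  choose P hPt hP using hnear
  obtain ⟨D, hDc, hDmin, hD⟩ := exists_countable_not_isMin (X := X)
  obtain ⟨E, hEc, hEmax, hE⟩ : ∃ E : Set X, E.Countable ∧ (∀ x ∈ E, ¬IsMax x) ∧
    ∀ u : X, ¬IsMax u → ∃ x ∈ E, u ≤ x := exists_countable_not_isMin (X := Xᵒᵈ)
  have := hDc.to_subtype
  have := hEc.to_subtype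
  have hfar := fun (d : D × E × ℕ) =>
    hf.exists_far_targets (hDmin _ d.1.2) (hEmax _ d.2.1.2) d.2.2
  choose k hk A B hA hB hsame hdiff using hfar
  -- In `T₁` and `T₂` both alternatives coincide, so the threshold `0` is a dummy.
  let T₁ : Set (Set X × Set X × ℝ) := range fun U => (Q U, Q U, 0)
  let T₂ : Set (Set X × Set X × ℝ) := range fun k => (P k, P k, 0)
  let T₃ : Set (Set X × Set X × ℝ) :=
    range fun d : (D × E × ℕ) × ℚ => (A d.1, B d.1, (d.2 : ℝ))
  obtain ⟨φ, hφ, hT⟩ := exists_measurable_itinerary_of_countable hf.continuous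
    (T := T₁ ∪ T₂ ∪ T₃)
    (((countable_range _).union (countable_range _)).union (countable_range _))
    ⟨_, Or.inl (Or.inr ⟨0, rfl⟩)⟩
    (by rintro _ ((⟨U, rfl⟩ | ⟨k, rfl⟩) | ⟨d, rfl⟩); exacts [hQt _, hPt _, hA _])
    (by rintro _ ((⟨U, rfl⟩ | ⟨k, rfl⟩) | ⟨d, rfl⟩); exacts [hQt _, hPt _, hB _])
  have hconst : ∀ Q : Set X, (Q, Q, (0 : ℝ)) ∈ T₁ ∪ T₂ ∪ T₃ → ∃ t, ∀ α, f^[t] (φ α) ∈ Q := by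
    intro Q hQ
    obtain ⟨t, ht⟩ := hT _ hQ
    exact ⟨t, fun α => (lt_or_ge α 0).elim (ht α).1 (ht α).2⟩
  refine ⟨φ, hφ, fun α => ?_, fun m n α β W hW => ?_, ?_⟩
  · refine (TopologicalSpace.isBasis_countableBasis X).dense_iff.mpr fun U hU _ => ?_
    obtain ⟨t, ht⟩ := hconst _ (Or.inl (Or.inl ⟨⟨U, hU⟩, rfl⟩))
    exact ⟨_, hQ _ (ht α), t, rfl⟩
  · obtain ⟨j, -, hj⟩ := hV.1.mem_iff.mp hW
    obtain ⟨t, ht⟩ := hconst _ (Or.inl (Or.inr ⟨max j (max m n), rfl⟩))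
    have hsub : V (max j (max m n)) ⊆ W := (hV.2 (le_max_left _ _)).trans hj
    refine ⟨t, hsub ?_, hsub ?_⟩
    · rw [add_comm, Function.iterate_add_apply]
      exact hP _ _ (ht α) m (by simp)
    · rw [add_comm, Function.iterate_add_apply]
      exact hP _ _ (ht β) n (by simp)
  · have hlt : ∀ m n α β, α < β → ∀ u v : X, ¬IsMin u → ¬IsMax v →
        ∃ i, 0 < i ∧ Icc u v ⊆ uIcc (f^[i + m] (φ α)) (f^[i + n] (φ β)) := by
      intro m n α β hαβ u v hu hv
      obtain ⟨q, hq, hq'⟩ := exists_rat_btwn hαβ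
      obtain ⟨u', hu'D, hu'⟩ := hD u hu
      obtain ⟨v', hv'E, hv'⟩ := hE v hv
      -- As `q` separates `α` from `β`, the first point enters `A` and the second `B`. With `i + n =
      -- t + 2k` the second is then in its far position, while `i + m = t + k + (k + m - n)` lies in
      -- the window from `t + k + 1` to `t + 3k` because `m + n < k`.
      let d : D × E × ℕ := (⟨u', hu'D⟩, ⟨v', hv'E⟩, m + n + 1)
      obtain ⟨t, ht⟩ := hT _ (Or.inr ⟨(d, q), rfl⟩)
      have hkd : m + n + 1 ≤ k d := hk d
      have h := hdiff d _ ((ht α).1 hq) _ ((ht β).2 hq'.le) (k d + m - n) (by omega) (by omega)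
      refine ⟨t + 2 * k d - n, by omega, ((Icc_subset_Icc hu' hv').trans h).trans_eq ?_⟩
      rw [← Function.iterate_add_apply, ← Function.iterate_add_apply, uIcc_comm,
        show k d + (k d + m - n) + t = t + 2 * k d - n + m by omega,
        show 2 * k d + t = t + 2 * k d - n + n by omega]
    have heq : ∀ m n α, m < n → ∀ u v : X, ¬IsMin u → ¬IsMax v →
        ∃ i, 0 < i ∧ Icc u v ⊆ uIcc (f^[i + m] (φ α)) (f^[i + n] (φ α)) := by
      intro m n α hmn u v hu hv
      -- Any threshold above `α` sends `φ α` into `A`, whose points change sides right after time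
      -- `k`. This separates two shifts of one orbit.
      obtain ⟨q, hq⟩ := exists_rat_gt α
      obtain ⟨u', hu'D, hu'⟩ := hD u hu
      obtain ⟨v', hv'E, hv'⟩ := hE v hv
      let d : D × E × ℕ := (⟨u', hu'D⟩, ⟨v', hv'E⟩, m + n + 1)
      obtain ⟨t, ht⟩ := hT _ (Or.inr ⟨(d, q), rfl⟩)
      have hkd : m + n + 1 ≤ k d := hk d
      have h := hsame d _ ((ht α).1 hq) (n - m) (by omega) (by omega)
      refine ⟨t + k d - m, by omega, ((Icc_subset_Icc hu' hv').trans h).trans_eq ?_⟩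
      rw [← Function.iterate_add_apply, ← Function.iterate_add_apply,
        show k d + t = t + k d - m + m by omega,
        show k d + (n - m) + t = t + k d - m + n by omega]
    intro m n α β hne u v hu hv
    rcases lt_trichotomy α β with h | rfl | h
    · exact hlt m n α β h u v hu hv
    · rcases lt_or_gt_of_ne (fun h : m = n => hne (by rw [h])) with h | h
      · exact heq m n α h u v hu hv
      · obtain ⟨i, hi, h⟩ := heq n m α h u v hu hv
        exact ⟨i, hi, by rwa [uIcc_comm]⟩
    · obtain ⟨i, hi, h⟩ := hlt n m β α h u v hu hv
      exact ⟨i, hi, by rwa [uIcc_comm]⟩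

end

/-! ### Scrambling sets, order reversal and conjugacy -/

/-- An invariant set of points with dense orbits, any two of which are infinitely often both close
to `p`, and infinitely often have any given compact interval in the interior between them. -/
structure IsScramblingSet {X : Type*} [LinearOrder X] [TopologicalSpace X] (f : X → X) (p : X)
    (S : Set X) : Prop where
  nontrivial : S.Nontrivial
  mapsTo : MapsTo f S S
  dense : ∀ x ∈ S, IsTransitivePoint f x
  near : ∀ c ∈ S, ∀ d ∈ S, c ≠ d → ∀ V ∈ 𝓝 p, ∃ᶠ i in atTop, f^[i] c ∈ V ∧ f^[i] d ∈ V
  far : ∀ c ∈ S, ∀ d ∈ S, c ≠ d → ∀ u v : X, ¬IsMin u → ¬IsMax v →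
    ∃ᶠ i in atTop, Icc u v ⊆ uIcc (f^[i] c) (f^[i] d)

theorem iterate_conj {X Y : Type*} (e : X ≃ Y) (f : X → X) (n : ℕ) :
    (e ∘ f ∘ e.symm)^[n] = e ∘ f^[n] ∘ e.symm := by
  induction n with
  | zero => ext; simp
  | succ n ih => rw [Function.iterate_succ', Function.iterate_succ', ih]; ext; simp

theorem image_conj {X Y : Type*} (e : X ≃ Y) (f : X → X) (s : Set Y) :
    (e ∘ f ∘ e.symm) '' s = e '' (f '' (e.symm '' s)) := by
  simp only [image_comp]

theorem image_uIcc_orderIso {X Y : Type*} [LinearOrder X] [LinearOrder Y] (e : X ≃o Y) (x y : X) : e '' uIcc x y = uIcc (e x) (e y) := by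
  rcases le_total x y with h | h
  · rw [uIcc_of_le h, uIcc_of_le (e.monotone h), e.image_Icc]
  · rw [uIcc_of_ge h, uIcc_of_ge (e.monotone h), e.image_Icc]

theorem subset_uIcc_orderIso_iff {X Y : Type*} [LinearOrder X] [LinearOrder Y] (e : X ≃o Y)
    (u v : Y) (x y : X) :
    Icc u v ⊆ uIcc (e x) (e y) ↔ Icc (e.symm u) (e.symm v) ⊆ uIcc x y := by
  rw [← image_uIcc_orderIso, ← image_subset_image_iff e.injective, e.image_Icc]
  simp

/-- `exists_far` is phrased with `uIcc`, hence does not say which interval lies on which side, and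
survives order reversal. This handles intervals with a greatest but no least element. -/
theorem IsExtremelyMixing.dual {X : Type*} [LinearOrder X] [TopologicalSpace X] {f : X → X}
    (hf : IsExtremelyMixing f) :
    IsExtremelyMixing (OrderDual.toDual ∘ f ∘ OrderDual.ofDual) := by
  have hIcc : ∀ a b : Xᵒᵈ, Icc a b = (Icc b.ofDual a.ofDual : Set X) := fun a b => by
    ext x
    exact and_comm
  refine ⟨hf.continuous, hf.exists_fixed, ?_, ?_⟩
  · intro a b u v hab
    have := hf.eventually_cover b.ofDual a.ofDual v.ofDual u.ofDual hab
    simp only [hIcc]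
    exact this
  · intro u v hu hv
    obtain ⟨a₀, b₀, a₁, b₁, h0, h1, hs, h01, h11⟩ := hf.exists_far v.ofDual u.ofDual hv hu
    refine ⟨.toDual b₀, .toDual a₀, .toDual b₁, .toDual a₁, h0, h1, ?_, ?_, ?_⟩
    · simp only [hIcc]
      intro x hx y hy
      refine (hs x hx y hy).trans_eq ?_
      exact (uIcc_toDual (a := x.ofDual) (b := y.ofDual)).symm
    · simp only [hIcc]; exact h01
    · simp only [hIcc]; exact h11

section conj

variable {X Y : Type*} [LinearOrder X] [TopologicalSpace X] [OrderTopology X]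
  [LinearOrder Y] [TopologicalSpace Y] [OrderTopology Y] {f : X → X}

theorem IsScramblingSet.conj {p : X} {S : Set X} (h : IsScramblingSet f p S) (e : X ≃o Y) :
    IsScramblingSet (e ∘ f ∘ e.symm) (e p) (e '' S) := by
  have hit := iterate_conj e.toEquiv f
  simp only [OrderIso.coe_toEquiv, OrderIso.coe_symm_toEquiv] at hit
  have hcont : Continuous e := e.toHomeomorph.continuous
  refine ⟨h.nontrivial.image e.injective, ?_, ?_, ?_, ?_⟩
  · rintro _ ⟨x, hx, rfl⟩
    simpa using h.mapsTo hx
  · rintro _ ⟨x, hx, rfl⟩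
    have := e.surjective.denseRange.dense_image hcont (h.dense x hx)
    rw [← range_comp] at this
    unfold IsTransitivePoint
    simp only [hit, Function.comp_apply, e.symm_apply_apply]
    exact this
  · rintro _ ⟨c, hc, rfl⟩ _ ⟨d, hd, rfl⟩ hcd V hV
    simpa [hit] using h.near c hc d hd (ne_of_apply_ne _ hcd) _ (hcont.continuousAt hV)
  · rintro _ ⟨c, hc, rfl⟩ _ ⟨d, hd, rfl⟩ hcd u v hu hv
    have := h.far c hc d hd (ne_of_apply_ne _ hcd) _ _ (e.symm.isMin_apply.not.mpr hu)
      (e.symm.isMax_apply.not.mpr hv)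
    simpa [hit, subset_uIcc_orderIso_iff] using this

theorem IsExtremelyMixing.conj (hf : IsExtremelyMixing f) (e : X ≃o Y) :
    IsExtremelyMixing (e ∘ f ∘ e.symm) := by
  have hit := iterate_conj e.toEquiv f
  have him : ∀ (g : X → X) (a b u v : Y), Icc u v ⊆ (e ∘ g ∘ e.symm) '' Icc a b ↔
      Icc (e.symm u) (e.symm v) ⊆ g '' Icc (e.symm a) (e.symm b) := by
    intro g a b u v
    have := image_conj e.toEquiv g (Icc a b)
    simp only [OrderIso.coe_toEquiv, OrderIso.coe_symm_toEquiv] at this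
    rw [this, e.symm.image_Icc, ← image_subset_image_iff e.injective
      (s := Icc (e.symm u) (e.symm v)), e.image_Icc]
    simp
  simp only [OrderIso.coe_toEquiv, OrderIso.coe_symm_toEquiv] at hit
  refine ⟨e.toHomeomorph.continuous.comp (hf.continuous.comp e.symm.toHomeomorph.continuous),
    ?_, ?_, ?_⟩
  · obtain ⟨p, hp⟩ := hf.exists_fixed
    exact ⟨e p, by simp [hp]⟩
  · intro a b u v hab
    filter_upwards [hf.eventually_cover (e.symm a) (e.symm b) (e.symm u) (e.symm v)
      (e.symm.strictMono hab)] with n hn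
    rwa [hit, him]
  · intro u v hu hv
    obtain ⟨a₀, b₀, a₁, b₁, h0, h1, hs, h01, h11⟩ := hf.exists_far (e.symm u) (e.symm v)
      (e.symm.isMin_apply.not.mpr hu) (e.symm.isMax_apply.not.mpr hv)
    refine ⟨e a₀, e b₀, e a₁, e b₁, e.strictMono h0, e.strictMono h1, ?_, ?_, ?_⟩
    · rw [← e.image_Icc, ← e.image_Icc]
      rintro _ ⟨x, hx, rfl⟩ _ ⟨y, hy, rfl⟩
      exact (subset_uIcc_orderIso_iff e u v x y).mpr (hs x hx y hy)
    · rw [him]; simpa using h01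
    · rw [him]; simpa using h11

end conj

/-! ### Distribution functions and transport of measures by order isomorphisms -/

theorem strictMono_measure_Iic {X : Type*} [LinearOrder X] [TopologicalSpace X] [OrderTopology X]
    [DenselyOrdered X] [MeasurableSpace X] [BorelSpace X] (μ : Measure X) [IsFiniteMeasure μ] [μ.IsOpenPosMeasure] :
    StrictMono fun x => μ (Iic x) := by
  intro x y hxy
  have h := (isOpen_Ioo.measure_pos μ (nonempty_Ioo.mpr hxy))
  have hsub : Ioo x y ⊆ Iic y \ Iic x := fun z hz => ⟨hz.2.le, not_le.mpr hz.1⟩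
  have h2 := h.trans_le (measure_mono hsub)
  rw [measure_sdiff (Iic_subset_Iic.mpr hxy.le) measurableSet_Iic.nullMeasurableSet
    (measure_ne_top _ _)] at h2
  exact tsub_pos_iff_lt.mp h2

/-- As `z` tends to `x`, the indicators of `Iic z` converge at every point other than `x`, and `x`
is null. -/
theorem continuous_measure_Iic {X : Type*} [LinearOrder X] [TopologicalSpace X] [OrderTopology X]
    [SecondCountableTopology X] [MeasurableSpace X] [BorelSpace X] (μ : Measure X) [IsFiniteMeasure μ] [NullSingletonClass μ] :
    Continuous fun x => μ (Iic x) := by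
  refine continuous_iff_continuousAt.mpr fun x => ?_
  refine tendsto_measure_of_ae_tendsto_indicator_of_isFiniteMeasure (𝓝 x) measurableSet_Iic
    (fun _ => measurableSet_Iic) ?_
  have : ∀ᵐ y ∂μ, y ≠ x := by simp [ae_iff]
  filter_upwards [this] with y hy
  rcases lt_or_gt_of_ne hy with h | h
  · filter_upwards [lt_mem_nhds h] with z hz
    simp [hz.le, h.le]
  · filter_upwards [gt_mem_nhds h] with z hz
    simp [not_le.mpr hz, not_le.mpr h]

section cdf

variable {X Y : Type*} [LinearOrder X] [TopologicalSpace X] [OrderTopology X] [DenselyOrdered X]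
  [PreconnectedSpace X] [SecondCountableTopology X] [MeasurableSpace X] [BorelSpace X]
  [LinearOrder Y] [TopologicalSpace Y] [OrderTopology Y] [DenselyOrdered Y]
  [PreconnectedSpace Y] [SecondCountableTopology Y] [MeasurableSpace Y] [BorelSpace Y]

/-- The point is that the range depends only on which ends of `X` are attained, not on `μ`, so two
distribution functions can be matched. -/
theorem range_measure_Iic (μ : Measure X) [IsProbabilityMeasure μ] [NullSingletonClass μ]
    [μ.IsOpenPosMeasure] : range (fun x => μ (Iic x)) =
      {r | r ≤ 1 ∧ (r = 0 → ∃ x : X, IsMin x) ∧ (r = 1 → ∃ x : X, IsMax x)} := by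
  have hmono := strictMono_measure_Iic μ
  ext r
  constructor
  · rintro ⟨x, rfl⟩
    refine ⟨prob_le_one, fun h => ⟨x, ?_⟩, fun h => ⟨x, ?_⟩⟩
    · by_contra hx
      obtain ⟨w, hw⟩ := not_isMin_iff.mp hx
      have := hmono hw
      simp_all
    · by_contra hx
      obtain ⟨w, hw⟩ := not_isMax_iff.mp hx
      have := hmono hw
      simp only at h this
      rw [h] at this
      exact this.not_ge prob_le_one
  · rintro ⟨hr, h0, h1⟩
    have : Nonempty X := by
      by_contra h
      rw [not_nonempty_iff] at h
      have := measure_univ (μ := μ)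
      rw [univ_eq_empty_iff.mpr h] at this
      simp at this
    have htop : Tendsto (fun x => μ (Iic x)) atTop (𝓝 1) := by
      simpa using tendsto_measure_Iic_atTop μ
    have hbot : Tendsto (fun x => μ (Iic x)) atBot (𝓝 0) := by
      have h := ENNReal.Tendsto.sub (tendsto_const_nhds (x := (1 : ℝ≥0∞)) (f := atBot))
        (tendsto_measure_Ici_atBot μ) (by simp)
      simp only [measure_univ, tsub_self] at h
      refine h.congr fun x => ?_
      rw [← prob_compl_eq_one_sub measurableSet_Ici, compl_Ici]
      exact measure_congr Iio_ae_eq_Iic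
    refine mem_range_of_exists_le_of_exists_ge (continuous_measure_Iic μ) ?_ ?_
    · rcases eq_or_ne r 0 with h | h
      · obtain ⟨x, hx⟩ := h0 h
        refine ⟨x, ?_⟩
        rw [hx.Iic_eq]
        simp
      · obtain ⟨x, hx⟩ := (hbot.eventually (gt_mem_nhds (pos_iff_ne_zero.mpr h))).exists
        exact ⟨x, hx.le⟩
    · rcases hr.eq_or_lt with h | h
      · obtain ⟨x, hx⟩ := h1 h
        refine ⟨x, ?_⟩
        have : Iic x = univ := eq_univ_of_forall fun y => hx.isTop y
        rw [this, measure_univ, h]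
      · obtain ⟨x, hx⟩ := (htop.eventually (lt_mem_nhds h)).exists
        exact ⟨x, hx.le⟩

/-- Both distribution functions are order isomorphisms onto the same range; `e` is one followed by
the inverse of the other. -/
theorem exists_orderIso_measure_Iic_eq (μ : Measure X) [IsProbabilityMeasure μ] [NullSingletonClass μ]
    [μ.IsOpenPosMeasure] (ν : Measure Y) [IsProbabilityMeasure ν] [NullSingletonClass ν]
    [ν.IsOpenPosMeasure] (hmin : (∃ x : X, IsMin x) ↔ ∃ y : Y, IsMin y)
    (hmax : (∃ x : X, IsMax x) ↔ ∃ y : Y, IsMax y) :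
    ∃ e : X ≃o Y, ∀ x, ν (Iic (e x)) = μ (Iic x) := by
  have hrange : range (fun x => μ (Iic x)) = range fun y => ν (Iic y) := by
    rw [range_measure_Iic, range_measure_Iic, hmin, hmax]
  let eX := (strictMono_measure_Iic μ).orderIso
  let eY := (strictMono_measure_Iic ν).orderIso
  let e := (eX.trans (OrderIso.setCongr _ _ hrange)).trans eY.symm
  refine ⟨e, fun x => ?_⟩
  have h : eY (e x) = OrderIso.setCongr _ _ hrange (eX x) := by simp [e]
  exact congrArg Subtype.val h

theorem exists_orderIso_map_eq (μ ν : Measure X) [IsProbabilityMeasure μ] [NullSingletonClass μ]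
    [μ.IsOpenPosMeasure] [IsProbabilityMeasure ν] [NullSingletonClass ν] [ν.IsOpenPosMeasure] :
    ∃ e : X ≃o X, μ.map e = ν := by
  obtain ⟨e, he⟩ := exists_orderIso_measure_Iic_eq μ ν Iff.rfl Iff.rfl
  have hmeas : Measurable e := e.toHomeomorph.continuous.measurable
  refine ⟨e, Measure.ext_of_Iic _ _ fun a => ?_⟩
  rw [Measure.map_apply hmeas measurableSet_Iic, ← e.apply_symm_apply a, he]
  congr 1
  ext x
  simp

end cdf

/-! ### An invariant scrambling set of full measure for some measure -/

instance nullSingletonClass_toFinite {X : Type*} [MeasurableSpace X] (μ : Measure X) [SFinite μ] [NullSingletonClass μ] :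
    NullSingletonClass μ.toFinite :=
  ⟨fun x => by simp⟩

instance isOpenPosMeasure_toFinite {X : Type*} [TopologicalSpace X] [MeasurableSpace X]
    (μ : Measure X) [SFinite μ] [μ.IsOpenPosMeasure] : μ.toFinite.IsOpenPosMeasure :=
  ⟨fun U hU hne => by simpa using hU.measure_ne_zero μ hne⟩

theorem IsExtremelyMixing.surjective {X : Type*} [LinearOrder X] [TopologicalSpace X]
    [Nontrivial X] {f : X → X} (hf : IsExtremelyMixing f) : Function.Surjective f := by
  intro y
  obtain ⟨a, b, hab⟩ := exists_pair_lt X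
  obtain ⟨n, hn, hn0⟩ := ((hf.eventually_cover a b y y hab).and (eventually_gt_atTop 0)).exists
  obtain ⟨x, -, rfl⟩ := hn (left_mem_Icc.mpr le_rfl)
  obtain ⟨m, rfl⟩ := Nat.exists_eq_succ_of_ne_zero hn0.ne'
  exact ⟨_, (Function.iterate_succ_apply' f m x).symm⟩

theorem IsExtremelyMixing.isBitransitive {X : Type*} [LinearOrder X] [TopologicalSpace X]
    [OrderTopology X] [DenselyOrdered X] [Nontrivial X] {f : X → X} (hf : IsExtremelyMixing f) : IsBitransitive f := by
  intro U V hU hV hUne hVne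
  obtain ⟨a, b, hab, hU'⟩ := exists_Icc_subset_of_isOpen hU hUne
  obtain ⟨y, hy⟩ := hVne
  obtain ⟨n, hn⟩ := eventually_atTop.mp (hf.eventually_cover a b y y hab)
  obtain ⟨x, hx, hxy⟩ := hn (2 * (n + 1)) (by omega) (left_mem_Icc.mpr le_rfl)
  refine ⟨n + 1, n.succ_pos, y, ⟨x, hU' hx, ?_⟩, hy⟩
  rw [← Function.iterate_mul, hxy]

section

variable {X : Type*} [LinearOrder X] [TopologicalSpace X] [OrderTopology X] [CompactIccSpace X]
  [DenselyOrdered X] [Nontrivial X] [SecondCountableTopology X] [MeasurableSpace X] [BorelSpace X]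
  {f : X → X}

/-- The measure is the sum over `n` of the images of a probability on `ℝ` under `f^[n] ∘ φ`, with
weights `2⁻¹ ^ (n + 1)`. Injectivity of these maps excludes atoms, and density of the orbits gives
full support. -/
theorem IsExtremelyMixing.exists_isScramblingSet (hf : IsExtremelyMixing f) {p : X}
    (hp : f p = p) : ∃ (μ : Measure X) (S : Set X), IsProbabilityMeasure μ ∧ NullSingletonClass μ ∧
      μ.IsOpenPosMeasure ∧ μ Sᶜ = 0 ∧ IsScramblingSet f p S := by
  obtain ⟨φ, hφ, hdense, hnear, hfar⟩ := hf.exists_coding hp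
  obtain ⟨u, v, huv, hu, hv⟩ : ∃ u v : X, u < v ∧ ¬IsMin u ∧ ¬IsMax v := by
    obtain ⟨a, b, hab⟩ := exists_pair_lt X
    obtain ⟨c, hac, hcb⟩ := exists_between hab
    obtain ⟨d, hcd, hdb⟩ := exists_between hcb
    exact ⟨c, d, hcd, not_isMin_iff.mpr ⟨a, hac⟩, not_isMax_iff.mpr ⟨b, hdb⟩⟩
  -- Equal points have equal iterates, which cannot enclose a nondegenerate interval.
  have hinj : ∀ m n α β, f^[m] (φ α) = f^[n] (φ β) → (m, α) = (n, β) := by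
    intro m n α β h
    by_contra hne
    obtain ⟨i, -, hi⟩ := hfar m n α β hne u v hu hv
    rw [Function.iterate_add_apply, Function.iterate_add_apply, h, uIcc_self] at hi
    have h1 := hi (left_mem_Icc.mpr huv.le)
    have h2 := hi (right_mem_Icc.mpr huv.le)
    exact huv.ne (h1.trans h2.symm)
  let ρ : Measure ℝ := (volume : Measure ℝ).toFinite
  have hmeas : ∀ n, Measurable (f^[n] ∘ φ) := fun n =>
    (hf.continuous.iterate n).measurable.comp hφ
  -- An injective Borel map on `ℝ` has Borel range (Lusin–Souslin), so `S` below is measurable.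
  have hembed : ∀ n, MeasurableEmbedding (f^[n] ∘ φ) := fun n =>
    (hmeas n).measurableEmbedding fun α β h => (Prod.ext_iff.mp (hinj n n α β h)).2
  let μ : Measure X :=
    Measure.sum fun n : ℕ => (2⁻¹ : ℝ≥0∞) ^ (n + 1) • ρ.map (f^[n] ∘ φ)
  have hμ : ∀ s, MeasurableSet s →
      μ s = ∑' n : ℕ, (2⁻¹ : ℝ≥0∞) ^ (n + 1) * ρ ((f^[n] ∘ φ) ⁻¹' s) := by
    intro s hs
    simp only [μ, Measure.sum_apply _ hs, Measure.smul_apply, smul_eq_mul,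
      Measure.map_apply (hmeas _) hs]
  let S : Set X := ⋃ n : ℕ, range (f^[n] ∘ φ)
  have hS : MeasurableSet S := MeasurableSet.iUnion fun n => (hembed n).measurableSet_range
  have hpow : ∑' n : ℕ, (2⁻¹ : ℝ≥0∞) ^ (n + 1) = 1 := by
    rw [ENNReal.tsum_geometric_add_one, ENNReal.one_sub_inv_two, inv_inv,
      ENNReal.inv_mul_cancel (by simp) (by simp)]
  refine ⟨μ, S, ⟨?_⟩, ⟨fun x => ?_⟩, ⟨fun U hU hne h0 => ?_⟩, ?_, ?_, ?_, ?_, ?_, ?_⟩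
  · rw [hμ _ MeasurableSet.univ]
    simp [hpow]
  · rw [hμ _ (measurableSet_singleton x), ENNReal.tsum_eq_zero]
    intro n
    have : ((f^[n] ∘ φ) ⁻¹' {x}).Subsingleton :=
      subsingleton_singleton.preimage (hembed n).injective
    rw [this.measure_zero, mul_zero]
  · rw [hμ _ hU.measurableSet, ENNReal.tsum_eq_zero] at h0
    -- Every orbit visits `U`, so these preimages cannot all be null.
    have hcover : ⋃ n : ℕ, (f^[n] ∘ φ) ⁻¹' U = univ := by
      refine eq_univ_of_forall fun α => ?_
      obtain ⟨_, hy, n, rfl⟩ := (hdense α).inter_open_nonempty U hU hne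
      exact mem_iUnion.mpr ⟨n, hy⟩
    have : ρ univ = 0 := by
      rw [← hcover]
      refine measure_iUnion_null fun n => ?_
      simpa using h0 n
    simp [ρ] at this
  · rw [hμ _ hS.compl, ENNReal.tsum_eq_zero]
    intro n
    have : (f^[n] ∘ φ) ⁻¹' Sᶜ = ∅ := by
      refine eq_empty_of_forall_notMem fun α hα => hα (mem_iUnion.mpr ⟨n, α, rfl⟩)
    rw [this, measure_empty, mul_zero]
  · refine ⟨φ 0, mem_iUnion.mpr ⟨0, 0, rfl⟩, φ 1, mem_iUnion.mpr ⟨0, 1, rfl⟩, fun h => ?_⟩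
    simpa using hinj 0 0 0 1 h
  · rintro _ ⟨_, ⟨n, rfl⟩, α, rfl⟩
    exact mem_iUnion.mpr ⟨n + 1, α, Function.iterate_succ_apply' f n (φ α)⟩
  · rintro _ ⟨_, ⟨n, rfl⟩, α, rfl⟩
    -- A continuous surjection maps the dense orbit of `φ α` to a dense set, which is the orbit of
    -- `f^[n] (φ α)`.
    have := (hf.surjective.iterate n).denseRange.dense_image (hf.continuous.iterate n) (hdense α)
    rw [← range_comp] at this
    refine this.mono ?_
    rintro _ ⟨i, rfl⟩
    exact ⟨i, by simp only [Function.comp_apply, ← Function.iterate_add_apply, add_comm]⟩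
  · rintro _ ⟨_, ⟨m, rfl⟩, α, rfl⟩ _ ⟨_, ⟨n, rfl⟩, β, rfl⟩ - V hV
    refine frequently_atTop.mpr fun N => ?_
    -- The coding gives only one time for each pair of shifts; raising both shifts by `N` gives
    -- times beyond `N`.
    obtain ⟨i, h1, h2⟩ := hnear (N + m) (N + n) α β V hV
    refine ⟨i + N, by omega, ?_⟩
    simp only [Function.comp_apply, ← Function.iterate_add_apply, add_assoc]
    exact ⟨h1, h2⟩
  · rintro _ ⟨_, ⟨m, rfl⟩, α, rfl⟩ _ ⟨_, ⟨n, rfl⟩, β, rfl⟩ hne u v hu hv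
    refine frequently_atTop.mpr fun N => ?_
    have hne' : (N + m, α) ≠ (N + n, β) := by
      rintro h
      simp only [Prod.mk.injEq, add_right_inj] at h
      exact hne (by rw [h.1, h.2])
    obtain ⟨i, -, hi⟩ := hfar (N + m) (N + n) α β hne' u v hu hv
    refine ⟨i + N, by omega, ?_⟩
    simpa only [Function.comp_apply, ← Function.iterate_add_apply, add_assoc] using hi

end

/-! ### Model maps: the compact interval -/

theorem isExtremelyMixing_restrict {I : Set ℝ} [I.OrdConnected] {g : ℝ → ℝ} (hg : Continuous g)
    (hI : MapsTo g I I) (hfix : ∃ p ∈ I, g p = p)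
    (hcover : ∀ a ∈ I, ∀ b ∈ I, ∀ u ∈ I, ∀ v ∈ I, a < b →
      ∀ᶠ n in atTop, Icc u v ⊆ g^[n] '' Icc a b)
    (hfar : ∀ u ∈ I, ∀ v ∈ I, (∃ x ∈ I, x < u) → (∃ x ∈ I, v < x) →
      ∃ a₀ ∈ I, ∃ b₀ ∈ I, ∃ a₁ ∈ I, ∃ b₁ ∈ I, a₀ < b₀ ∧ a₁ < b₁ ∧ v ≤ a₀ ∧ b₁ ≤ u ∧
        Icc a₁ b₁ ⊆ g '' Icc a₀ b₀ ∧ Icc a₁ b₁ ⊆ g '' Icc a₁ b₁) :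
    IsExtremelyMixing (hI.restrict g I I) := by
  have him : ∀ (n : ℕ) (a b u v : I), Icc (u : ℝ) v ⊆ g^[n] '' Icc (a : ℝ) b →
      Icc u v ⊆ (hI.restrict g I I)^[n] '' Icc a b := by
    intro n a b u v h z hz
    obtain ⟨x, hx, hxz⟩ := h ⟨hz.1, hz.2⟩
    refine ⟨⟨x, Set.OrdConnected.out ‹_› a.2 b.2 hx⟩, ⟨hx.1, hx.2⟩, ?_⟩
    rw [hI.iterate_restrict]
    exact Subtype.ext hxz
  refine ⟨hg.continuousOn.mapsToRestrict hI, ?_, ?_, ?_⟩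
  · obtain ⟨p, hpI, hp⟩ := hfix
    exact ⟨⟨p, hpI⟩, Subtype.ext hp⟩
  · intro a b u v hab
    filter_upwards [hcover a a.2 b b.2 u u.2 v v.2 hab] with n hn
    exact him n a b u v hn
  · intro u v hu hv
    obtain ⟨x, hx⟩ := not_isMin_iff.mp hu
    obtain ⟨y, hy⟩ := not_isMax_iff.mp hv
    obtain ⟨a₀, ha₀, b₀, hb₀, a₁, ha₁, b₁, hb₁, h0, h1, hva, hub, h01, h11⟩ :=
      hfar u u.2 v v.2 ⟨x, x.2, hx⟩ ⟨y, y.2, hy⟩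
    refine ⟨⟨a₀, ha₀⟩, ⟨b₀, hb₀⟩, ⟨a₁, ha₁⟩, ⟨b₁, hb₁⟩, h0, h1, ?_,
      him 1 ⟨a₀, ha₀⟩ ⟨b₀, hb₀⟩ ⟨a₁, ha₁⟩ ⟨b₁, hb₁⟩ h01,
      him 1 ⟨a₁, ha₁⟩ ⟨b₁, hb₁⟩ ⟨a₁, ha₁⟩ ⟨b₁, hb₁⟩ h11⟩
    intro x hx y hy z hz
    refine mem_uIcc.mpr (Or.inr ⟨?_, ?_⟩)
    · exact hy.2.trans (le_trans (show (⟨b₁, hb₁⟩ : I) ≤ u from hub) hz.1)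
    · exact hz.2.trans (le_trans (show v ≤ (⟨a₀, ha₀⟩ : I) from hva) hx.1)

section quadratic

theorem iterate_quadratic_neg_cos (n : ℕ) (θ : ℝ) :
    (fun x : ℝ => 1 - 2 * x ^ 2)^[n] (-Real.cos θ) = -Real.cos (2 ^ n * θ) := by
  induction n with
  | zero => simp
  | succ n ih =>
    rw [Function.iterate_succ_apply', ih, pow_succ' (2 : ℝ), mul_assoc, Real.cos_two_mul]
    ring

/-- In the coordinate `x = -cos θ` the map doubles `θ`. Once `2 ^ n` times the angular length
reaches `2π`, a full period of the cosine is covered. -/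
theorem Icc_subset_iterate_quadratic {a b : ℝ} (ha : -1 ≤ a) (hb : b ≤ 1) (hab : a < b) :
    ∀ᶠ n in atTop, Icc (-1) 1 ⊆ (fun x : ℝ => 1 - 2 * x ^ 2)^[n] '' Icc a b := by
  have hlt : Real.arccos (-a) < Real.arccos (-b) :=
    Real.strictAntiOn_arccos ⟨by linarith, by linarith⟩ ⟨by linarith, by linarith⟩ (by linarith)
  have hlim : Tendsto (fun n : ℕ => (2 : ℝ) ^ n * (Real.arccos (-b) - Real.arccos (-a)))
      atTop atTop :=
    (tendsto_pow_atTop_atTop_of_one_lt one_lt_two).atTop_mul_const (by linarith)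
  filter_upwards [hlim.eventually_ge_atTop (2 * Real.pi)] with n hn y hy
  obtain ⟨θ, hθ, hcos⟩ := Real.cos_periodic.exists_mem_Ico Real.two_pi_pos (Real.arccos (-y))
    (2 ^ n * Real.arccos (-a))
  rw [Real.cos_arccos (by linarith [hy.2]) (by linarith [hy.1])] at hcos
  have h2 : (0 : ℝ) < 2 ^ n := by positivity
  have h1 : Real.arccos (-a) ≤ θ / 2 ^ n := by
    rw [le_div_iff₀ h2]; linarith [hθ.1]
  have h3 : θ / 2 ^ n ≤ Real.arccos (-b) := by
    rw [div_le_iff₀ h2]; linarith [hθ.2]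
  refine ⟨-Real.cos (θ / 2 ^ n), ⟨?_, ?_⟩, ?_⟩
  · have := Real.cos_le_cos_of_nonneg_of_le_pi (Real.arccos_nonneg _)
      (h3.trans (Real.arccos_le_pi _)) h1
    rw [Real.cos_arccos (by linarith) (by linarith)] at this
    linarith
  · have := Real.cos_le_cos_of_nonneg_of_le_pi ((Real.arccos_nonneg _).trans h1)
      (Real.arccos_le_pi _) h3
    rw [Real.cos_arccos (by linarith) (by linarith)] at this
    linarith
  · rw [iterate_quadratic_neg_cos, mul_div_cancel₀ _ h2.ne', ← hcos, neg_neg]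

theorem exists_isExtremelyMixing_Icc :
    ∃ f : Icc (-1 : ℝ) 1 → Icc (-1 : ℝ) 1, IsExtremelyMixing f := by
  have hcont : Continuous fun x : ℝ => 1 - 2 * x ^ 2 := by fun_prop
  have hmaps : MapsTo (fun x : ℝ => 1 - 2 * x ^ 2) (Icc (-1) 1) (Icc (-1) 1) := fun x hx =>
    ⟨by nlinarith [hx.1, hx.2], by nlinarith [sq_nonneg x]⟩
  refine ⟨_, isExtremelyMixing_restrict hcont hmaps ⟨-1, by simp, by norm_num⟩ ?_ ?_⟩
  · intro a ha b hb u hu v hv hab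
    filter_upwards [Icc_subset_iterate_quadratic ha.1 hb.2 hab] with n hn
    exact (Icc_subset_Icc hu.1 hv.2).trans hn
  · rintro u hu v hv ⟨x, hx, hxu⟩ ⟨y, hy, hvy⟩
    -- The point `1` maps to the repelling fixed point `-1`, so one-sided neighbourhoods of size `ε`
    -- of these two points serve. The bound `ε ≤ 1` ensures `-1 + ε ≤ 1 - 2 * (1 - ε) ^ 2`.
    obtain ⟨ε, hε, hε'⟩ : ∃ ε : ℝ, 0 < ε ∧ ε ≤ min (min (u + 1) (1 - v)) 1 :=
      ⟨_, lt_min (lt_min (by linarith [hx.1]) (by linarith [hy.2])) one_pos, le_rfl⟩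
    simp only [le_min_iff] at hε'
    obtain ⟨⟨h1, h2⟩, h3⟩ := hε'
    refine ⟨1 - ε, ⟨by linarith, by linarith⟩, 1, by simp, -1, by simp, -1 + ε,
      ⟨by linarith, by linarith⟩, by linarith, by linarith, by linarith, by linarith, ?_, ?_⟩
    · refine Subset.trans (Icc_subset_Icc ?_ ?_)
        (intermediate_value_Icc' (by linarith) hcont.continuousOn)
      · norm_num
      · nlinarith
    · refine Subset.trans (Icc_subset_Icc ?_ ?_)
        (intermediate_value_Icc (by linarith) hcont.continuousOn)
      · norm_num
      · nlinarith

end quadratic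

/-! ### Model maps: half-lines and the line -/

section expanding

/-- An interval containing no full lap `[j, j + 1]` of this form meets at most two laps in
nondegenerate pieces. The longer piece has at least half the length and is stretched fourfold, so
the length at least doubles; an interval of length `2` contains a lap. -/
theorem exists_lap_subset_iterate {g : ℝ → ℝ} (hg : Continuous g)
    (hexp : ∀ (j : ℤ), ∀ x ∈ Icc (j : ℝ) (j + 1), ∀ y ∈ Icc (j : ℝ) (j + 1),
      4 * |x - y| ≤ |g x - g y|) {a b : ℝ} (hab : a < b) :
    ∃ (n : ℕ) (j : ℤ), Icc (j : ℝ) (j + 1) ⊆ g^[n] '' Icc a b := by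
  obtain ⟨n, hn⟩ : ∃ n : ℕ, 2 ≤ 2 ^ n * (b - a) :=
    (((tendsto_pow_atTop_atTop_of_one_lt (one_lt_two (α := ℝ))).atTop_mul_const
      (sub_pos.mpr hab)).eventually_ge_atTop 2).exists
  induction n generalizing a b with
  | zero =>
    refine ⟨0, ⌈a⌉, ?_⟩
    simp only [Function.iterate_zero, image_id]
    exact Icc_subset_Icc (Int.le_ceil a) (by linarith [Int.ceil_lt_add_one a])
  | succ n ih =>
    have key : ∀ (j : ℤ) (c d : ℝ), a ≤ c → c < d → d ≤ b → (j : ℝ) ≤ c → d ≤ j + 1 →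
        b - a ≤ 2 * (d - c) →
        ∃ (n : ℕ) (j : ℤ), Icc (j : ℝ) (j + 1) ⊆ g^[n] '' Icc a b := by
      intro j c d hac hcd hdb hjc hdj hlen
      have h := hexp j d ⟨by linarith, hdj⟩ c ⟨hjc, by linarith⟩
      rw [abs_of_pos (sub_pos.mpr hcd), abs_sub_comm, ← max_sub_min_eq_abs'] at h
      have h2 : (0 : ℝ) < 2 ^ n := by positivity
      obtain ⟨m, i, hm⟩ := ih (a := min (g c) (g d)) (b := max (g c) (g d)) (by linarith) (by
        rw [pow_succ] at hn
        nlinarith)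
      refine ⟨m + 1, i, hm.trans ?_⟩
      rw [Function.iterate_succ, image_comp]
      exact image_mono ((intermediate_value_uIcc hg.continuousOn).trans
        (image_mono ((uIcc_of_le hcd.le).trans_subset (Icc_subset_Icc hac hdb))))
    have hj := Int.le_ceil a
    have hj' := Int.ceil_lt_add_one a
    rcases le_or_gt b ⌈a⌉ with h | h
    · refine key (⌈a⌉ - 1) a b le_rfl hab le_rfl ?_ ?_ ?_
      · push_cast; linarith
      · push_cast; linarith
      · linarith
    rcases le_or_gt ((⌈a⌉ : ℝ) + 1) b with h' | h'
    · exact ⟨0, ⌈a⌉, by simpa using Icc_subset_Icc hj h'⟩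
    rcases le_or_gt (b - ⌈a⌉) (⌈a⌉ - a) with h'' | h''
    · refine key (⌈a⌉ - 1) a ⌈a⌉ le_rfl ?_ h.le ?_ ?_ ?_
      · linarith
      · push_cast; linarith
      · push_cast; linarith
      · linarith
    · exact key ⌈a⌉ ⌈a⌉ b hj h le_rfl le_rfl h'.le (by linarith)

/-- Once an image contains a lap, the next contains `J 0`, and each further step advances one term
along `J`; hence the covering holds at all late times. -/
theorem eventually_subset_iterate_of_exhaustion {g : ℝ → ℝ} (hg : Continuous g)
    (hexp : ∀ (j : ℤ), ∀ x ∈ Icc (j : ℝ) (j + 1), ∀ y ∈ Icc (j : ℝ) (j + 1),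
      4 * |x - y| ≤ |g x - g y|) {J : ℕ → Set ℝ} (hJ : ∀ j : ℤ, J 0 ⊆ g '' Icc (j : ℝ) (j + 1))
    (hJsucc : ∀ m, J (m + 1) ⊆ g '' J m) {a b : ℝ} (hab : a < b) {K : Set ℝ}
    (hK : ∀ᶠ m in atTop, K ⊆ J m) : ∀ᶠ n in atTop, K ⊆ g^[n] '' Icc a b := by
  obtain ⟨n, j, hn⟩ := exists_lap_subset_iterate hg hexp hab
  have h : ∀ m, J m ⊆ g^[m + (n + 1)] '' Icc a b := by
    intro m
    induction m with
    | zero =>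
      rw [zero_add, Function.iterate_succ', image_comp]
      exact (hJ j).trans (image_mono hn)
    | succ m ih =>
      rw [add_right_comm, Function.iterate_succ', image_comp]
      exact (hJsucc m).trans (image_mono ih)
  filter_upwards [(tendsto_sub_atTop_nat (n + 1)).eventually hK, eventually_ge_atTop (n + 1)]
    with i hi hni
  have := h (i - (n + 1))
  rw [Nat.sub_add_cancel hni] at this
  exact hi.trans this

/-- The distance to the nearest even integer. -/
noncomputable def wave (x : ℝ) : ℝ := Real.arccos (Real.cos (Real.pi * x)) / Real.pi

theorem continuous_wave : Continuous wave := by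
  unfold wave
  exact (Real.continuous_arccos.comp (by fun_prop)).div_const _

theorem wave_nonneg (x : ℝ) : 0 ≤ wave x := div_nonneg (Real.arccos_nonneg _) Real.pi_pos.le

theorem wave_le_one (x : ℝ) : wave x ≤ 1 := (div_le_one Real.pi_pos).mpr (Real.arccos_le_pi _)

theorem wave_of_mem {x : ℝ} (hx : x ∈ Icc (0 : ℝ) 1) : wave x = x := by
  rw [wave, Real.arccos_cos (mul_nonneg Real.pi_pos.le hx.1)
    (mul_le_of_le_one_right Real.pi_pos.le hx.2), mul_div_cancel_left₀ _ Real.pi_ne_zero]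

theorem wave_neg (x : ℝ) : wave (-x) = wave x := by simp [wave]

theorem wave_sub_two_mul (x : ℝ) (k : ℤ) : wave (x - 2 * k) = wave x := by
  rw [wave, wave, mul_sub, show Real.pi * (2 * (k : ℝ)) = k * (2 * Real.pi) by ring,
    Real.cos_sub_int_mul_two_pi]

theorem wave_even_lap {x : ℝ} (k : ℤ) (h₁ : 2 * (k : ℝ) ≤ x) (h₂ : x ≤ 2 * k + 1) :
    wave x = x - 2 * k := by
  rw [← wave_sub_two_mul x k, wave_of_mem ⟨by linarith, by linarith⟩]

theorem wave_odd_lap {x : ℝ} (k : ℤ) (h₁ : 2 * (k : ℝ) + 1 ≤ x) (h₂ : x ≤ 2 * k + 2) :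
    wave x = 2 * k + 2 - x := by
  rw [← wave_sub_two_mul x (k + 1), ← wave_neg, wave_of_mem] <;> push_cast
  · ring
  · exact ⟨by linarith, by linarith⟩

theorem abs_wave_sub_wave {j : ℤ} {x y : ℝ} (hx : x ∈ Icc (j : ℝ) (j + 1))
    (hy : y ∈ Icc (j : ℝ) (j + 1)) : |wave x - wave y| = |x - y| := by
  obtain ⟨k, rfl | rfl⟩ := Int.even_or_odd' j <;> push_cast at hx hy
  · rw [wave_even_lap k hx.1 hx.2, wave_even_lap k hy.1 hy.2]
    ring_nf
  · rw [wave_odd_lap k hx.1 (by linarith [hx.2]), wave_odd_lap k hy.1 (by linarith [hy.2]),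
      abs_sub_comm x y]
    ring_nf

theorem wave_lap_endpoints (j : ℤ) :
    (wave j = 0 ∧ wave (j + 1) = 1) ∨ (wave j = 1 ∧ wave (j + 1) = 0) := by
  obtain ⟨k, rfl | rfl⟩ := Int.even_or_odd' j <;> push_cast
  · left
    rw [wave_even_lap k le_rfl (by linarith), wave_even_lap k (by linarith) le_rfl]
    constructor <;> ring
  · right
    rw [wave_odd_lap k le_rfl (by linarith), wave_odd_lap k (by linarith) (by linarith)]
    constructor <;> ring

/-- A product of `|x| + c` with an affine function of `wave` of slope `s` expands every lap. -/
theorem expanding_mul_wave {c s r : ℝ} (hc : 5 ≤ c * |s|) (hs : 0 ≤ c)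
    (hr : ∀ x, |s * wave x + r| ≤ 1) (j : ℤ) (x : ℝ) (hx : x ∈ Icc (j : ℝ) (j + 1)) (y : ℝ)
    (hy : y ∈ Icc (j : ℝ) (j + 1)) :
    4 * |x - y| ≤ |(|x| + c) * (s * wave x + r) - (|y| + c) * (s * wave y + r)| := by
  -- The variation of `wave` contributes at least `5 * |x - y|` and that of the factor `|x| + c`
  -- takes away at most `|x - y|`, which leaves the factor `4`.
  have h1 : (|x| + c) * (s * wave x + r) - (|y| + c) * (s * wave y + r) =
      (|x| + c) * s * (wave x - wave y) - (s * wave y + r) * (|y| - |x|) := by ring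
  have h2 : |(|x| + c) * s * (wave x - wave y)| = (|x| + c) * |s| * |x - y| := by
    rw [abs_mul, abs_mul, abs_wave_sub_wave hx hy, abs_of_nonneg (by positivity : 0 ≤ |x| + c)]
  have h3 : |(s * wave y + r) * (|y| - |x|)| ≤ |x - y| := by
    rw [abs_mul, abs_sub_comm x y]
    calc _ ≤ 1 * |y - x| := mul_le_mul (hr y) (abs_abs_sub_abs_le _ _) (abs_nonneg _) zero_le_one
      _ = _ := one_mul _
  have h4 : 5 * |x - y| ≤ (|x| + c) * |s| * |x - y| := by
    refine mul_le_mul_of_nonneg_right ?_ (abs_nonneg _)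
    nlinarith [mul_nonneg (abs_nonneg x) (abs_nonneg s)]
  rw [h1]
  have := abs_sub_abs_le_abs_sub ((|x| + c) * s * (wave x - wave y))
    ((s * wave y + r) * (|y| - |x|))
  linarith

theorem Icc_subset_image_lap {g : ℝ → ℝ} (hg : Continuous g) {x y a b : ℝ} (hab : a ≤ b)
    (h : (g a ≤ x ∧ y ≤ g b) ∨ (g b ≤ x ∧ y ≤ g a)) : Icc x y ⊆ g '' Icc a b := by
  rcases h with ⟨h1, h2⟩ | ⟨h1, h2⟩
  · exact (Icc_subset_Icc h1 h2).trans (intermediate_value_Icc hab hg.continuousOn)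
  · exact (Icc_subset_Icc h1 h2).trans (intermediate_value_Icc' hab hg.continuousOn)

theorem exists_isExtremelyMixing_Ici :
    ∃ f : Ici (0 : ℝ) → Ici (0 : ℝ), IsExtremelyMixing f := by
  let g : ℝ → ℝ := fun x => (|x| + 5) * (1 * wave x + 0)
  have hg : Continuous g := by
    have := continuous_wave
    fun_prop
  have hexp := expanding_mul_wave (c := 5) (s := 1) (r := 0) (by norm_num) (by norm_num)
    (fun x => by simpa [abs_of_nonneg (wave_nonneg x)] using wave_le_one x)
  have hmaps : MapsTo g (Ici 0) (Ici 0) := fun x _ =>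
    mul_nonneg (by positivity : 0 ≤ |x| + 5) (by simpa using wave_nonneg x)
  -- The peak sits at `j` or at `j + 1`, according to parity; `|j| + 4` is a lower bound for its
  -- height in both cases.
  have hlap : ∀ j : ℤ, Icc 0 (|(j : ℝ)| + 4) ⊆ g '' Icc (j : ℝ) (j + 1) := by
    intro j
    refine Icc_subset_image_lap hg (by linarith) ?_
    have h := abs_sub_abs_le_abs_sub (j : ℝ) (j + 1)
    rw [show (j : ℝ) - (j + 1) = -1 by ring, abs_neg, abs_one] at h
    rcases wave_lap_endpoints j with ⟨h1, h2⟩ | ⟨h1, h2⟩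
    · left; simp only [g, h1, h2]; constructor <;> linarith
    · right; simp only [g, h1, h2]; constructor <;> linarith
  have hw0 : wave 0 = 0 := wave_of_mem (by simp)
  refine ⟨_, isExtremelyMixing_restrict hg hmaps ⟨0, by simp, by simp [g, hw0]⟩ ?_ ?_⟩
  · intro a _ b _ u hu v _ hab
    refine eventually_subset_iterate_of_exhaustion hg hexp (J := fun m => Icc 0 ((m : ℝ) + 4))
      ?_ ?_ hab ?_
    · intro j
      refine (Icc_subset_Icc le_rfl ?_).trans (hlap j)
      simp
    · intro m
      -- The last lap `[m + 3, m + 4]` of the `m`-th interval already covers `[0, m + 7]`.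
      refine Subset.trans (Icc_subset_Icc le_rfl ?_)
        ((hlap (m + 3)).trans (image_mono (Icc_subset_Icc ?_ ?_)))
      · rw [abs_of_nonneg (by positivity)]; push_cast; linarith
      · positivity
      · push_cast; linarith
    · filter_upwards [(tendsto_natCast_atTop_atTop (R := ℝ)).eventually_ge_atTop v] with m hm
      exact Icc_subset_Icc hu (by linarith)
  · rintro u hu v hv ⟨x, hx, hxu⟩ -
    have hu0 : 0 < u := lt_of_le_of_lt hx hxu
    obtain ⟨N, hN⟩ := exists_nat_ge v
    have hN0 : (0 : ℝ) ≤ N := N.cast_nonneg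
    have hm0 : 0 < min u 1 := lt_min hu0 one_pos
    have hm1 : min u 1 ≤ 1 := min_le_right _ _
    -- A lap beyond `v` covers the interval near `0`, which covers itself because `0` is a repelling
    -- fixed point.
    refine ⟨N, hN0, N + 1, by simp only [mem_Ici]; linarith, 0, by simp, min u 1, hm0.le,
      by linarith, hm0, hN, min_le_left _ _, ?_, ?_⟩
    · refine Subset.trans (Icc_subset_Icc le_rfl ?_) ((hlap N).trans ?_)
      · linarith [abs_nonneg ((N : ℤ) : ℝ)]
      · simp
    · refine Icc_subset_image_lap hg hm0.le (Or.inl ⟨(by simp [g, hw0] : g 0 ≤ 0), ?_⟩)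
      simp only [g, wave_of_mem ⟨hm0.le, hm1⟩, abs_of_pos hm0]
      nlinarith

theorem exists_isExtremelyMixing_univ :
    ∃ f : ↥(univ : Set ℝ) → ↥(univ : Set ℝ), IsExtremelyMixing f := by
  -- The second factor runs between `-1` and `1` on each lap, so the images of laps grow in both
  -- directions.
  let g : ℝ → ℝ := fun x => (|x| + 3) * (-2 * wave x + 1)
  have hg : Continuous g := by
    have := continuous_wave
    fun_prop
  have hexp := expanding_mul_wave (c := 3) (s := -2) (r := 1) (by norm_num) (by norm_num)
    (fun x => abs_le.mpr ⟨by linarith [wave_le_one x], by linarith [wave_nonneg x]⟩)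
  have hlap : ∀ j : ℤ, Icc (-(|(j : ℝ)| + 2)) (|(j : ℝ)| + 2) ⊆ g '' Icc (j : ℝ) (j + 1) := by
    intro j
    refine Icc_subset_image_lap hg (by linarith) ?_
    have h := abs_sub_abs_le_abs_sub (j : ℝ) (j + 1)
    rw [show (j : ℝ) - (j + 1) = -1 by ring, abs_neg, abs_one] at h
    rcases wave_lap_endpoints j with ⟨h1, h2⟩ | ⟨h1, h2⟩
    · right; simp only [g, h1, h2]; constructor <;> linarith
    · left; simp only [g, h1, h2]; constructor <;> linarith
  have hfix : ∃ p ∈ (univ : Set ℝ), g p = p := by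
    obtain ⟨p, -, hp⟩ := exists_mem_Icc_isFixedPt hg.continuousOn (zero_le_one (α := ℝ))
      (by simp [g, wave_of_mem (x := 0)]) (by simp [g, wave_of_mem (x := 1)]; norm_num)
    exact ⟨p, trivial, hp⟩
  refine ⟨_, isExtremelyMixing_restrict hg (mapsTo_univ g univ) hfix ?_ ?_⟩
  · intro a _ b _ u _ v _ hab
    refine eventually_subset_iterate_of_exhaustion hg hexp
      (J := fun m => Icc (-((m : ℝ) + 2)) ((m : ℝ) + 2)) ?_ ?_ hab ?_
    · intro j
      refine (Icc_subset_Icc ?_ ?_).trans (hlap j) <;> simp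
    · intro m
      refine Subset.trans ?_ ((hlap (m + 1)).trans (image_mono (Icc_subset_Icc ?_ ?_)))
      · rw [abs_of_nonneg (by positivity)]
        push_cast
        exact Icc_subset_Icc (by linarith) (by linarith)
      · push_cast; linarith [(m.cast_nonneg : (0 : ℝ) ≤ m)]
      · push_cast; linarith
    · filter_upwards [(tendsto_natCast_atTop_atTop (R := ℝ)).eventually_ge_atTop v,
        (tendsto_natCast_atTop_atTop (R := ℝ)).eventually_ge_atTop (-u)] with m hm hm'
      exact Icc_subset_Icc (by linarith) (by linarith)
  · rintro u - v - - -
    obtain ⟨N, hN⟩ := exists_nat_ge (max v (-u))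
    obtain ⟨hv, hu⟩ := max_le_iff.mp hN
    have hN0 : (0 : ℝ) ≤ N := N.cast_nonneg
    refine ⟨N, trivial, N + 1, trivial, -N - 1, trivial, -N, trivial, by linarith, by linarith,
      hv, by linarith, ?_, ?_⟩
    · refine Subset.trans (Icc_subset_Icc ?_ ?_) ((hlap N).trans (by simp))
      · simp; linarith
      · simp; linarith
    · have h := hlap (-N - 1)
      push_cast at h
      rw [sub_add_cancel, abs_of_nonpos (by linarith)] at h
      exact (Icc_subset_Icc (by linarith) (by linarith)).trans h

theorem exists_isExtremelyMixing_Iic :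
    ∃ f : Iic (0 : ℝ) → Iic (0 : ℝ), IsExtremelyMixing f := by
  obtain ⟨f, hf⟩ := exists_isExtremelyMixing_Ici
  let e : (Ici (0 : ℝ))ᵒᵈ ≃o Iic (0 : ℝ) :=
    { toFun := fun x => ⟨-(x.ofDual : ℝ), neg_nonpos.mpr (mem_Ici.mp x.ofDual.2)⟩
      invFun := fun x => .toDual ⟨-(x : ℝ), neg_nonneg.mpr (mem_Iic.mp x.2)⟩
      left_inv := fun x => by simp
      right_inv := fun x => by simp
      map_rel_iff' := fun {x y} =>
        neg_le_neg_iff (a := (x.ofDual : ℝ)) (b := (y.ofDual : ℝ)) }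
  exact ⟨_, hf.dual.conj e⟩

end expanding

/-! ### Arbitrary intervals and the conclusion -/

theorem compactIccSpace_of_ordConnected (I : Set ℝ) [hI : I.OrdConnected] : CompactIccSpace I := by
  refine ⟨fun {a b} => ?_⟩
  rw [Topology.IsEmbedding.subtypeVal.isCompact_iff]
  have : Subtype.val '' Icc a b = Icc (a : ℝ) b := by
    ext x
    constructor
    · rintro ⟨y, hy, rfl⟩
      exact hy
    · exact fun hx => ⟨⟨x, hI.out a.2 b.2 hx⟩, hx, rfl⟩
  rw [this]
  exact isCompact_Icc

/-- A normalization of Lebesgue measure up to null sets, valid for unbounded `I` as well; this is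
the measure to which `μ` is transported. -/
theorem exists_probability_interval (I : Set ℝ) [hI : I.OrdConnected] [Nontrivial I] :
    ∃ ρ : Measure I, IsProbabilityMeasure ρ ∧ NullSingletonClass ρ ∧ ρ.IsOpenPosMeasure ∧
      ∀ s, ρ s = 0 → volume (Subtype.val '' s) = 0 := by
  let ν : Measure I := Measure.comap Subtype.val (volume : Measure ℝ).toFinite
  have hν : ∀ s, ν s = 0 ↔ volume (Subtype.val '' s) = 0 := fun s => by
    rw [comap_subtype_coe_apply hI.measurableSet, toFinite_apply_eq_zero_iff]
  have hnull : NullSingletonClass ν :=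
    ⟨fun x => by rw [hν, image_singleton]; exact measure_singleton _⟩
  have hpos : ν.IsOpenPosMeasure := by
    refine ⟨fun U hU hne h0 => ?_⟩
    obtain ⟨a, b, hab, h⟩ := exists_Icc_subset_of_isOpen hU hne
    rw [hν] at h0
    have hsub : Icc (a : ℝ) b ⊆ Subtype.val '' U := fun x hx =>
      ⟨⟨x, hI.out a.2 b.2 hx⟩, h hx, rfl⟩
    have h1 := measure_mono_null hsub h0
    rw [Real.volume_Icc, ENNReal.ofReal_eq_zero] at h1
    exact hab.not_ge (sub_nonpos.mp h1 : (b : ℝ) ≤ a)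
  have hne : NeZero ν := ⟨fun h => by
    have := isOpen_univ.measure_ne_zero ν univ_nonempty
    simp [h] at this⟩
  exact ⟨ν.toFinite, inferInstance, inferInstance, inferInstance, fun s hs => by
    rwa [toFinite_apply_eq_zero_iff, hν] at hs⟩

/-- The matching of distribution functions is reused here only for the order isomorphism it
produces. -/
theorem nonempty_orderIso_interval (I J : Set ℝ) [hI : I.OrdConnected] [Nontrivial I]
    [hJ : J.OrdConnected] [Nontrivial J] (hmin : (∃ x : I, IsMin x) ↔ ∃ x : J, IsMin x)
    (hmax : (∃ x : I, IsMax x) ↔ ∃ x : J, IsMax x) : Nonempty (I ≃o J) := by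
  have := Subtype.preconnectedSpace hI.isPreconnected
  have := Subtype.preconnectedSpace hJ.isPreconnected
  obtain ⟨μ, _, _, _, -⟩ := exists_probability_interval I
  obtain ⟨ν, _, _, _, -⟩ := exists_probability_interval J
  obtain ⟨e, -⟩ := exists_orderIso_measure_Iic_eq μ ν hmin hmax
  exact ⟨e⟩

/-- Up to order isomorphism only the presence of a least and of a greatest element matters, not
boundedness, so four models suffice. -/
theorem exists_isExtremelyMixing (I : Set ℝ) [I.OrdConnected] [Nontrivial I] :
    ∃ f : I → I, IsExtremelyMixing f := by
  have transfer : ∀ (J : Set ℝ) [J.OrdConnected] [Nontrivial J],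
      (∃ f : J → J, IsExtremelyMixing f) →
      ((∃ x : J, IsMin x) ↔ ∃ x : I, IsMin x) → ((∃ x : J, IsMax x) ↔ ∃ x : I, IsMax x) →
      ∃ f : I → I, IsExtremelyMixing f := by
    rintro J _ _ ⟨f, hf⟩ hmin hmax
    obtain ⟨e⟩ := nonempty_orderIso_interval J I hmin hmax
    exact ⟨_, hf.conj e⟩
  by_cases hmin : ∃ x : I, IsMin x <;> by_cases hmax : ∃ x : I, IsMax x
  · have : Nontrivial (Icc (-1 : ℝ) 1) :=
      nontrivial_coe_sort.mpr ⟨-1, by simp, 1, by simp, by norm_num⟩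
    refine transfer _ exists_isExtremelyMixing_Icc (iff_of_true ?_ hmin) (iff_of_true ?_ hmax)
    · exact ⟨⟨-1, by simp⟩, fun y _ => y.2.1⟩
    · exact ⟨⟨1, by simp⟩, fun y _ => y.2.2⟩
  · have : Nontrivial (Ici (0 : ℝ)) :=
      nontrivial_coe_sort.mpr ⟨0, by simp, 1, by simp, by norm_num⟩
    refine transfer _ exists_isExtremelyMixing_Ici (iff_of_true ?_ hmin) (iff_of_false ?_ hmax)
    · exact ⟨⟨0, by simp⟩, fun y _ => y.2⟩
    · rintro ⟨x, hx⟩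
      exact not_isMax x hx
  · have : Nontrivial (Iic (0 : ℝ)) :=
      nontrivial_coe_sort.mpr ⟨0, by simp, -1, by simp, by norm_num⟩
    refine transfer _ exists_isExtremelyMixing_Iic (iff_of_false ?_ hmin) (iff_of_true ?_ hmax)
    · rintro ⟨x, hx⟩
      exact not_isMin x hx
    · exact ⟨⟨0, by simp⟩, fun y _ => y.2⟩
  · have : Nontrivial (univ : Set ℝ) := nontrivial_coe_sort.mpr nontrivial_univ
    refine transfer _ exists_isExtremelyMixing_univ (iff_of_false ?_ hmin) (iff_of_false ?_ hmax)
    · rintro ⟨x, hx⟩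
      exact not_isMin_iff.mpr ⟨⟨(x : ℝ) - 1, trivial⟩, sub_one_lt (x : ℝ)⟩ hx
    · rintro ⟨x, hx⟩
      exact not_isMax_iff.mpr ⟨⟨(x : ℝ) + 1, trivial⟩, lt_add_one (x : ℝ)⟩ hx

theorem not_isMin_of_mem_interior {I : Set ℝ} {u : ℝ} (hu : u ∈ interior I) :
    ¬IsMin (⟨u, interior_subset hu⟩ : I) := by
  obtain ⟨w, hw, hwI⟩ :=
    (((eventually_mem_set.mpr (mem_interior_iff_mem_nhds.mp hu)).filter_mono
      (nhdsWithin_le_nhds (s := Iio u))).and self_mem_nhdsWithin).exists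
  exact not_isMin_iff.mpr ⟨⟨w, hw⟩, hwI⟩

theorem not_isMax_of_mem_interior {I : Set ℝ} {u : ℝ} (hu : u ∈ interior I) :
    ¬IsMax (⟨u, interior_subset hu⟩ : I) := by
  obtain ⟨w, hw, hwI⟩ :=
    (((eventually_mem_set.mpr (mem_interior_iff_mem_nhds.mp hu)).filter_mono
      (nhdsWithin_le_nhds (s := Ioi u))).and self_mem_nhdsWithin).exists
  exact not_isMax_iff.mpr ⟨⟨w, hw⟩, hwI⟩

theorem Icc_coe_subset_uIcc_coe {I : Set ℝ} [hI : I.OrdConnected] {u v x y : I}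
    (h : Icc u v ⊆ uIcc x y) : Icc (u : ℝ) v ⊆ uIcc (x : ℝ) y := by
  intro z hz
  have := h (show (⟨z, hI.out u.2 v.2 hz⟩ : I) ∈ Icc u v from hz)
  simpa [mem_uIcc, ← Subtype.coe_le_coe] using this

theorem IsScramblingSet.isExtremelyScrambledSet {I : Set ℝ} [I.OrdConnected] [Nontrivial I]
    {f : I → I} {p : I} {S : Set I} (h : IsScramblingSet f p S) : IsExtremelyScrambledSet f S := by
  obtain ⟨u, v, huv, hu, hv⟩ : ∃ u v : I, u < v ∧ ¬IsMin u ∧ ¬IsMax v := by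
    obtain ⟨a, b, hab⟩ := exists_pair_lt I
    obtain ⟨c, hac, hcb⟩ := exists_between hab
    obtain ⟨d, hcd, hdb⟩ := exists_between hcb
    exact ⟨c, d, hcd, not_isMin_iff.mpr ⟨a, hac⟩, not_isMax_iff.mpr ⟨b, hdb⟩⟩
  -- The length of any one interval with non-extremal endpoints can serve as `β`, since iterates of
  -- distinct points enclose it infinitely often.
  refine ⟨⟨edist u v, edist_pos.mpr huv.ne, h.nontrivial, fun c hc d hd hcd => ⟨?_, ?_⟩⟩, ?_⟩
  · refine le_antisymm (le_of_forall_pos_le_add fun ε hε => ?_) zero_le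
    rw [zero_add]
    refine liminf_le_of_frequently_le' ?_
    refine (h.near c hc d hd hcd _ (Metric.eball_mem_nhds p (ENNReal.half_pos hε.ne'))).mono ?_
    rintro n ⟨h1, h2⟩
    calc _ ≤ edist (f^[n] c) p + edist (f^[n] d) p := edist_triangle_right _ _ _
      _ ≤ ε / 2 + ε / 2 := add_le_add (le_of_lt h1) (le_of_lt h2)
      _ = ε := ENNReal.add_halves ε
  · refine le_limsup_of_frequently_le' ((h.far c hc d hd hcd u v hu hv).mono fun n hn => ?_)
    have h := Icc_coe_subset_uIcc_coe hn
    rw [edist_dist, edist_dist]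
    exact ENNReal.ofReal_le_ofReal (Real.dist_le_of_mem_uIcc
      (h (left_mem_Icc.mpr huv.le)) (h (right_mem_Icc.mpr huv.le)))
  · intro c hc d hd hcd u v huv hK
    have hu := hK (left_mem_Icc.mpr huv.le)
    have hv := hK (right_mem_Icc.mpr huv.le)
    obtain ⟨n, hn, hn0⟩ := ((h.far c hc d hd hcd ⟨u, interior_subset hu⟩ ⟨v, interior_subset hv⟩
      (not_isMin_of_mem_interior hu) (not_isMax_of_mem_interior hv)).and_eventually
      (eventually_gt_atTop 0)).exists
    exact ⟨n, hn0, Icc_coe_subset_uIcc_coe hn⟩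

end IntervalDynamics

theorem corollary12 (I : Set ℝ) (hI : I.OrdConnected) (hI' : I.Nontrivial) :
    ∃ f : I → I, Continuous f ∧ Function.Surjective f ∧ IntervalDynamics.IsBitransitive f ∧
      ∃ S : Set I, Set.MapsTo f S S ∧ IntervalDynamics.IsExtremelyScrambledSet f S ∧
        (∀ x ∈ S, IntervalDynamics.IsTransitivePoint f x) ∧
        MeasureTheory.volume (I \ (Subtype.val '' S)) = 0 := by
  have : Nontrivial I := nontrivial_coe_sort.mpr hI'
  have := IntervalDynamics.compactIccSpace_of_ordConnected I
  have := Subtype.preconnectedSpace hI.isPreconnected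
  obtain ⟨f, hf⟩ := IntervalDynamics.exists_isExtremelyMixing I
  obtain ⟨p, hp⟩ := hf.exists_fixed
  obtain ⟨μ, S, _, _, _, hμ, hS⟩ := hf.exists_isScramblingSet hp
  obtain ⟨ρ, _, _, _, hρ⟩ := IntervalDynamics.exists_probability_interval I
  -- From here on the reference measure is `μ.map e`, for which `e '' S` has full measure because
  -- `S` has full `μ`-measure.
  obtain ⟨e, rfl⟩ := IntervalDynamics.exists_orderIso_map_eq μ ρ
  have hf' := hf.conj e
  have hS' := hS.conj e
  refine ⟨_, hf'.continuous, hf'.surjective, hf'.isBitransitive, _, hS'.mapsTo,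
    hS'.isExtremelyScrambledSet, hS'.dense, ?_⟩
  have hnull : μ.map e (e '' S)ᶜ = 0 := by
    have h := e.toHomeomorph.measurableEmbedding.map_apply μ (e '' S)ᶜ
    rw [preimage_compl, e.coe_toHomeomorph, preimage_image_eq _ e.injective, hμ] at h
    exact h
  have h := hρ _ hnull
  rwa [image_compl_eq_range_sdiff_image Subtype.val_injective, Subtype.range_coe] at h
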